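/- Let $G$ be a ribbon graph: a compact surface (possibly non-orientable, possibly disconnected), written as a union of finitely many closed discs called vertices and finitely many rectangles (ribbons) called edges or chords, each ribbon being glued to the boundaries of the vertices along its two ends; the gluing segments are pairwise disjoint. Let $E$ be the set of edges, and let $V=\mathbb F_2^{2|E|}$ be the vector space with basis $(e_i,f_i)_{i\in E}$ and symplectic form $(e_i,f_j)=\delta_{ij}$, $(e_i,e_j)=(f_i,f_j)=0$. *L-space.* Let $\widehat G$ be $G$ with an open disc removed from the interior of every vertex. For $i\in E$ let $\alpha_i$ be a path inside the ribbon $i$ connecting its two free sides, and let $\beta_i$ be a path running along the ribbon $i$ and connecting the boundaries of the punctures of the vertices at its two ends. For $\gamma\in H_1(\widehat G;\mathbb F_2)$ let $\gamma\cap\alpha_i$, $\gamma\cap\beta_i\in\mathbb F_2$ be the intersection indices, and put $$L(G)=\Big\{\sum_{i\in E}(\gamma\cap\beta_i)\,e_i+\sum_{i\in E}(\gamma\cap\alpha_i)\,f_i \;:\; \gamma\in H_1(\widehat G;\mathbb F_2)\Big\}\subset V .$$ Let $L'(G)$ be the same space with the roles of $e$ and $f$ exchanged: $$L'(G)=\Big\{\sum_{i\in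 E}(\gamma\cap\alpha_i)\,e_i+\sum_{i\in E}(\gamma\cap\beta_i)\,f_i \;:\; \gamma\in H_1(\widehat G;\mathbb F_2)\Big\}.$$ (For a one-vertex graph with intersection matrix $A$ these are the row spaces of $(A\mid \mathrm{Id})$ and of $(\mathrm{Id}\mid A)$.) *Operations.* The partial dual $\mu_i(G)$ is obtained as follows: in the union of the boundary circles of the vertices replace the two gluing segments of the ribbon $i$ by its two free sides, attach new vertex discs to the resulting circles, and glue the same ribbons back. Now let $i\ne j$ be two edges with an end of $i$ and an end of $j$ neighbouring each other on the boundary of a vertex (joined by an arc of this boundary without further gluing segments; the two ends and the arc are part of the data). The first Vassiliev move $v_1^{ij}(G)$ glues these two ends, without reversing them, to the same pair of segments in the other order. The second Vassiliev move $v_2^{ij}(G)$ slides the chosen end of $j$ (the moving edge) along the adjacent free side of the ribbon $i$ (the fixed edge) until it reaches the vertex at the other end of $i$. **Theorem.** Define linear maps of $V$, all basis vectors that are not mentioned being fixed: - $M_i$: $e_i\mapsto f_i$, $f_i\mapsto e_i$; - $T_1^{ij}$: $f_i\mapsto f_i+e_j$, $f_j\mapsto f_j+e_i$; - $T_2^{ij}$: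 $e_i\mapsto e_i+e_j$, $f_j\mapsto f_j+f_i$; and let $T_1'^{ij}$, $T_2'^{ij}$ be $T_1^{ij}$, $T_2^{ij}$ with the letters $e$ and $f$ exchanged. Then for every ribbon graph $G$: 1. for every edge $i$: $L(\mu_i(G))=M_i(L(G))$ and $L'(\mu_i(G))=M_i(L'(G))$; 2. for all edges $i\neq j$ with neighbouring ends as above: $L(v_1^{ij}(G))=T_1^{ij}(L(G))$ and $L'(v_1^{ij}(G))=T_1'^{ij}(L'(G))$; 3. for all edges $i\neq j$ with neighbouring ends as above: $L(v_2^{ij}(G))=T_2^{ij}(L(G))$ and $L'(v_2^{ij}(G))=T_2'^{ij}(L'(G))$. -/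

import Mathlib

/-!
Ribbon graphs with edge set `E`, in the standard combinatorial encoding by corners of ribbons.

Every edge is a rectangle. It is glued to the vertex discs along its two *ends* (indexed by the
first `Bool`), and its two other sides, its *shores*, are indexed by the second `Bool`.
-/

/-- The four corners `(e, s, t)` of every edge rectangle `e`: the corner of end `s` and shore `t`. -/
abbrev Corner (E : Type*) := E × Bool × Bool

/-- The other corner of the same end: the two are joined by the segment along which the ribbon is
glued to a vertex disc. -/
def Corner.acrossEnd {E : Type*} (x : Corner E) : Corner E := (x.1, x.2.1, !x.2.2)

/-- The other corner of the same shore: the two are joined by a free side of the ribbon. -/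
def Corner.alongShore {E : Type*} (x : Corner E) : Corner E := (x.1, !x.2.1, x.2.2)

/-- A ribbon graph (possibly disconnected, possibly non-orientable) with edge set `E`.

The boundary circles of the vertex discs that meet an edge are cut, by the gluing segments, into
gluing segments and free arcs; `arc x` is the other endpoint of the free arc which starts at the
corner `x`. The vertices that meet an edge are the orbits of the corners under `arc` and
`Corner.acrossEnd` (walking around the boundary of the disc). Any fixed-point-free involution of the
corners occurs. The remaining vertices are discs without edges, and only their number matters. -/
structure RibbonGraph (E : Type*) where
  arc : Corner E → Corner E
  arc_arc : ∀ x, arc (arc x) = x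
  arc_ne : ∀ x, arc x ≠ x
  /-- the number of vertices to which no edge is attached -/
  isolated : ℕ

namespace RibbonGraph

variable {E : Type*}

/-! ### Operations on ribbon graphs -/

/-- The corner `σ x` takes the place which the corner `x` had on the boundary of the vertex discs;
the free arcs stay. -/
def reattach (G : RibbonGraph E) (σ : Equiv.Perm (Corner E)) : RibbonGraph E where
  arc x := σ (G.arc (σ.symm x))
  arc_arc x := by simp [G.arc_arc]
  arc_ne x h := G.arc_ne (σ.symm x) (by
    apply σ.injective
    simpa using h)
  isolated := G.isolated

/-- The involution of the corners which transposes the rectangle `i` (ends become shores, shores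
become ends), and fixes the corners of the other rectangles. -/
def transposeEdge [DecidableEq E] (i : E) : Equiv.Perm (Corner E) :=
  Function.Involutive.toPerm
    (fun x => if x.1 = i then (x.1, x.2.2, x.2.1) else x)
    (by
      rintro ⟨k, s, t⟩
      by_cases h : k = i <;> simp [h])

/-- The partial dual (Morse perestroika) `μ_i`. The new system of circles is the old one without
the two gluing segments of the ribbon `i`, together with the two shores of this ribbon; discs are
attached to these circles, and the same ribbons are glued back. So all free arcs stay, and the
ribbon `i` is now glued along its former shores: they have to be called ends, and the former ends
shores. -/
def partialDual [DecidableEq E] (G : RibbonGraph E) (i : E) : RibbonGraph E :=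
  G.reattach (transposeEdge i)

/-- First Vassiliev move, for neighbouring corners `x`, `y = arc x` of two distinct edges.
Write `x'`, `y'` for the other corners of the two ends. Along the boundary of the vertex one meets
`… p, x' x, y y', q …` before the move, and `… p, y y', x' x, q …` after the move: the
two ends are glued to the same two segments in the other order. -/
def vassiliev1 [DecidableEq E] (G : RibbonGraph E) (x y : Corner E) : RibbonGraph E :=
  G.reattach (Equiv.swap x.acrossEnd y * Equiv.swap x y.acrossEnd)

/-- Second Vassiliev move, for neighbouring corners `x`, `y = arc x` of two distinct edges: the edge
of `x` is fixed, and the end of the edge of `y` slides along the shore of the fixed edge that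
starts at `x`, to the other corner `x''` of this shore, where the free arc to `r = arc x''` starts.
Let `y'` be the other corner of the sliding end and `q = arc y'`. The free arcs
`r x''`, `x y`, `y' q` before the move are replaced by `r y`, `y' x''`, `x q`. -/
def vassiliev2 [DecidableEq E] (G : RibbonGraph E) (x y : Corner E) : RibbonGraph E :=
  G.reattach (Equiv.swap x.alongShore y * Equiv.swap x y.acrossEnd)

/-! ### The punctured surface and its first homology

The punctured surface is obtained by removing an open disc from each vertex, so each vertex
becomes an annulus. An annulus that meets an edge is cut by one radial segment at every corner into
rectangular sectors, one for every gluing segment and one for every free arc. The annulus of an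
isolated vertex is cut by one radial segment. -/

/-- The free arcs of the boundary circles of the vertices, as unordered pairs of corners. -/
def Arc (G : RibbonGraph E) : Type _ := {p : Sym2 (Corner E) // ∃ x, p = s(x, G.arc x)}

/-- Points of the cell structure. -/
inductive Cell0 (G : RibbonGraph E)
  | outer (x : Corner E)
  | inner (x : Corner E)
  | isoOuter (v : Fin G.isolated)
  | isoInner (v : Fin G.isolated)

/-- Segments of the cell structure. Those named `inner…` lie on the boundary of the puncture,
opposite to a gluing segment or to a free arc. -/
inductive Cell1 (G : RibbonGraph E)
  | glue (e : E) (s : Bool)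
  | shore (e : E) (t : Bool)
  | arc (a : G.Arc)
  | radial (x : Corner E)
  | innerGlue (e : E) (s : Bool)
  | innerArc (a : G.Arc)
  | isoOuter (v : Fin G.isolated)
  | isoInner (v : Fin G.isolated)
  | isoRadial (v : Fin G.isolated)

/-- Faces of the cell structure: the ribbons, the sectors of the annuli, the isolated annuli. -/
inductive Cell2 (G : RibbonGraph E)
  | ribbon (e : E)
  | glueSector (e : E) (s : Bool)
  | arcSector (a : G.Arc)
  | isoAnnulus (v : Fin G.isolated)

/-- Chains with coefficients in the field of two elements. -/
abbrev Chain (C : Type*) := C →₀ ZMod 2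

/-- A cell, as a chain. -/
noncomputable abbrev cell {C : Type*} (c : C) : Chain C := Finsupp.single c 1

/-- The sum of the two values of `g` at the members of an unordered pair. -/
noncomputable def pairSum {X C : Type*} (g : X → C) (p : Sym2 X) : Chain C :=
  Sym2.lift ⟨fun a b => cell (g a) + cell (g b), fun _ _ => add_comm _ _⟩ p

theorem pairSum_mk {X C : Type*} (g : X → C) (a b : X) :
    pairSum g s(a, b) = cell (g a) + cell (g b) := rfl

/-- The boundary of a segment. -/
noncomputable def bd1 (G : RibbonGraph E) : Cell1 G → Chain (Cell0 G)
  | .glue e s => cell (.outer (e, s, false)) + cell (.outer (e, s, true))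
  | .shore e t => cell (.outer (e, false, t)) + cell (.outer (e, true, t))
  | .arc a => pairSum Cell0.outer a.1
  | .radial x => cell (.outer x) + cell (.inner x)
  | .innerGlue e s => cell (.inner (e, s, false)) + cell (.inner (e, s, true))
  | .innerArc a => pairSum Cell0.inner a.1
  | .isoOuter _ => 0
  | .isoInner _ => 0
  | .isoRadial v => cell (.isoOuter v) + cell (.isoInner v)

/-- The boundary of a face (modulo 2; the radial segment occurs twice in an isolated annulus). -/
noncomputable def bd2 (G : RibbonGraph E) : Cell2 G → Chain (Cell1 G)
  | .ribbon e => cell (.glue e false) + cell (.glue e true) +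
      (cell (.shore e false) + cell (.shore e true))
  | .glueSector e s => cell (.glue e s) + cell (.innerGlue e s) +
      (cell (.radial (e, s, false)) + cell (.radial (e, s, true)))
  | .arcSector a => cell (.arc a) + cell (.innerArc a) + pairSum Cell1.radial a.1
  | .isoAnnulus v => cell (.isoOuter v) + cell (.isoInner v)

/-- The boundary map from 1-chains to 0-chains. -/
noncomputable def boundary1 (G : RibbonGraph E) : Chain (Cell1 G) →ₗ[ZMod 2] Chain (Cell0 G) :=
  Finsupp.linearCombination (ZMod 2) G.bd1

/-- The boundary map from 2-chains to 1-chains. -/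
noncomputable def boundary2 (G : RibbonGraph E) : Chain (Cell2 G) →ₗ[ZMod 2] Chain (Cell1 G) :=
  Finsupp.linearCombination (ZMod 2) G.bd2

theorem chain_add_self {C : Type*} (c : Chain C) : c + c = 0 := by
  ext i
  exact CharTwo.add_self_eq_zero (c i)

theorem boundary1_cell (G : RibbonGraph E) (c : Cell1 G) : G.boundary1 (cell c) = G.bd1 c := by
  simp [boundary1]

/-- The maps form a chain complex. -/
theorem boundary1_boundary2 (G : RibbonGraph E) (c : Chain (Cell2 G)) :
    G.boundary1 (G.boundary2 c) = 0 := by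
  have key : G.boundary1 ∘ₗ G.boundary2 = 0 := by
    apply Finsupp.lhom_ext'
    intro c
    apply LinearMap.ext_ring
    have h2 : G.boundary2 (cell c) = G.bd2 c := by simp [boundary2]
    change G.boundary1 (G.boundary2 (cell c)) = 0
    rw [h2]
    rcases c with e | ⟨e, s⟩ | ⟨p, hp⟩ | v
    · simp only [bd2, map_add, boundary1_cell, bd1]
      rw [← chain_add_self (cell (Cell0.outer (e, false, false) : Cell0 G) +
        cell (.outer (e, false, true)) + cell (.outer (e, true, false)) +
        cell (.outer (e, true, true)))]
      abel
    · simp only [bd2, map_add, boundary1_cell, bd1]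
      rw [← chain_add_self (cell (Cell0.outer (e, s, false) : Cell0 G) +
        cell (.outer (e, s, true)) + cell (.inner (e, s, false)) +
        cell (.inner (e, s, true)))]
      abel
    · induction p using Sym2.ind with
      | _ a b =>
        simp only [bd2, map_add, boundary1_cell, bd1, pairSum_mk]
        rw [← chain_add_self (cell (Cell0.outer a : Cell0 G) +
          cell (.outer b) + cell (.inner a) + cell (.inner b))]
        abel
    · simp [bd2, map_add, boundary1_cell, bd1]
  exact LinearMap.congr_fun key c

/-- The first homology group of the punctured surface with coefficients in the field of two
elements: cycles modulo boundaries, as the space of the classes of cycles in the quotient of all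
1-chains by the boundaries. -/
noncomputable def H1 (G : RibbonGraph E) :
    Submodule (ZMod 2) (Chain (Cell1 G) ⧸ LinearMap.range G.boundary2) :=
  (LinearMap.ker G.boundary1).map (LinearMap.range G.boundary2).mkQ

/-! ### Intersection indices and the L-space

The path `α_i` runs inside the ribbon `i` from the midpoint of one shore to the midpoint of the
other one. The path `β_i` runs along the ribbon `i` from puncture to puncture, through the
midpoints of the two gluing segments and of the two inner segments opposite to them. Both are
transverse to the 1-skeleton, and the intersection index with a cellular cycle counts modulo 2 the
segments of the cycle that the path meets (a segment in the boundary of the surface being pushed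
into the interior). -/

/-- The number, modulo 2, of intersections of a 1-chain with `α_i`. -/
noncomputable def alphaChain (G : RibbonGraph E) (i : E) : Chain (Cell1 G) →ₗ[ZMod 2] ZMod 2 :=
  Finsupp.lapply (.shore i false) + Finsupp.lapply (.shore i true)

/-- The number, modulo 2, of intersections of a 1-chain with `β_i`. -/
noncomputable def betaChain (G : RibbonGraph E) (i : E) : Chain (Cell1 G) →ₗ[ZMod 2] ZMod 2 :=
  Finsupp.lapply (.innerGlue i false) + Finsupp.lapply (.glue i false) +
    (Finsupp.lapply (.glue i true) + Finsupp.lapply (.innerGlue i true))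

theorem alphaChain_boundary2 (G : RibbonGraph E) (i : E) (c : Chain (Cell2 G)) :
    G.alphaChain i (G.boundary2 c) = 0 := by
  classical
  have key : G.alphaChain i ∘ₗ G.boundary2 = 0 := by
    apply Finsupp.lhom_ext'
    intro c
    apply LinearMap.ext_ring
    have h2 : G.boundary2 (cell c) = G.bd2 c := by simp [boundary2]
    change G.alphaChain i (G.boundary2 (cell c)) = 0
    rw [h2]
    rcases c with e | ⟨e, s⟩ | ⟨p, hp⟩ | v
    · by_cases h : e = i <;> simp [bd2, alphaChain, h] <;> exact CharTwo.add_self_eq_zero _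
    · simp [bd2, alphaChain]
    · induction p using Sym2.ind with
      | _ a b => simp [bd2, alphaChain, pairSum_mk]
    · simp [bd2, alphaChain]
  exact LinearMap.congr_fun key c

theorem betaChain_boundary2 (G : RibbonGraph E) (i : E) (c : Chain (Cell2 G)) :
    G.betaChain i (G.boundary2 c) = 0 := by
  classical
  have key : G.betaChain i ∘ₗ G.boundary2 = 0 := by
    apply Finsupp.lhom_ext'
    intro c
    apply LinearMap.ext_ring
    have h2 : G.boundary2 (cell c) = G.bd2 c := by simp [boundary2]
    change G.betaChain i (G.boundary2 (cell c)) = 0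
    rw [h2]
    rcases c with e | ⟨e, s⟩ | ⟨p, hp⟩ | v
    · by_cases h : e = i <;> simp [bd2, betaChain, h] <;> exact CharTwo.add_self_eq_zero _
    · by_cases h : e = i <;> cases s <;>
        simp [bd2, betaChain, h] <;> exact CharTwo.add_self_eq_zero _
    · induction p using Sym2.ind with
      | _ a b => simp [bd2, betaChain, pairSum_mk]
    · simp [bd2, betaChain]
  exact LinearMap.congr_fun key c

/-- The intersection index of a homology class with `α_i`. -/
noncomputable def capAlpha (G : RibbonGraph E) (i : E) : G.H1 →ₗ[ZMod 2] ZMod 2 :=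
  (Submodule.liftQ (LinearMap.range G.boundary2) (G.alphaChain i) (by
    rintro _ ⟨c, rfl⟩
    exact G.alphaChain_boundary2 i c)) ∘ₗ G.H1.subtype

/-- The intersection index of a homology class with `β_i`. -/
noncomputable def capBeta (G : RibbonGraph E) (i : E) : G.H1 →ₗ[ZMod 2] ZMod 2 :=
  (Submodule.liftQ (LinearMap.range G.boundary2) (G.betaChain i) (by
    rintro _ ⟨c, rfl⟩
    exact G.betaChain_boundary2 i c)) ∘ₗ G.H1.subtype

end RibbonGraph

/-- The space `V` with standard basis `e_i`, `f_i`, over the field of two elements. -/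
abbrev SymplecticSpace (E : Type*) := E ⊕ E → ZMod 2

namespace SymplecticSpace

variable {E : Type*} [Fintype E] [DecidableEq E]

/-- The basis vector `e_i`. -/
def e (i : E) : SymplecticSpace E := Pi.single (Sum.inl i) 1

/-- The basis vector `f_i`. -/
def f (i : E) : SymplecticSpace E := Pi.single (Sum.inr i) 1

/-- The linear map with prescribed images `a i` of `e_i` and `b i` of `f_i`. -/
noncomputable def ofBasis (a b : E → SymplecticSpace E) :
    SymplecticSpace E →ₗ[ZMod 2] SymplecticSpace E :=
  (Pi.basisFun (ZMod 2) (E ⊕ E)).constr (ZMod 2) (Sum.elim a b)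

/-- `e_i ↦ f_i`, `f_i ↦ e_i`, the other basis vectors are fixed. -/
noncomputable def M (i : E) : SymplecticSpace E →ₗ[ZMod 2] SymplecticSpace E :=
  ofBasis (fun k => if k = i then f i else e k) (fun k => if k = i then e i else f k)

/-- `f_i ↦ f_i + e_j`, `f_j ↦ f_j + e_i`, the other basis vectors are fixed. -/
noncomputable def T1 (i j : E) : SymplecticSpace E →ₗ[ZMod 2] SymplecticSpace E :=
  ofBasis e (fun k => if k = i then f i + e j else if k = j then f j + e i else f k)

/-- `e_i ↦ e_i + e_j`, `f_j ↦ f_j + f_i`, the other basis vectors are fixed. -/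
noncomputable def T2 (i j : E) : SymplecticSpace E →ₗ[ZMod 2] SymplecticSpace E :=
  ofBasis (fun k => if k = i then e i + e j else e k) (fun k => if k = j then f j + f i else f k)

/-- `T1` with the letters `e` and `f` exchanged: `e_i ↦ e_i + f_j`, `e_j ↦ e_j + f_i`. -/
noncomputable def T1' (i j : E) : SymplecticSpace E →ₗ[ZMod 2] SymplecticSpace E :=
  ofBasis (fun k => if k = i then e i + f j else if k = j then e j + f i else e k) f

/-- `T2` with the letters `e` and `f` exchanged: `f_i ↦ f_i + f_j`, `e_j ↦ e_j + e_i`. -/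
noncomputable def T2' (i j : E) : SymplecticSpace E →ₗ[ZMod 2] SymplecticSpace E :=
  ofBasis (fun k => if k = j then e j + e i else e k) (fun k => if k = i then f i + f j else f k)

end SymplecticSpace

namespace RibbonGraph

variable {E : Type*} [Fintype E] [DecidableEq E]

/-- `γ ↦ ∑ (γ ∩ β_i) e_i + ∑ (γ ∩ α_i) f_i`. In this labelling the L-space of a
one-vertex graph is spanned by the rows of `(A | Id)`, `A` the intersection matrix. -/
noncomputable def phi (G : RibbonGraph E) : G.H1 →ₗ[ZMod 2] SymplecticSpace E :=
  ∑ i, (G.capBeta i).smulRight (SymplecticSpace.e i) +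
    ∑ i, (G.capAlpha i).smulRight (SymplecticSpace.f i)

/-- `γ ↦ ∑ (γ ∩ α_i) e_i + ∑ (γ ∩ β_i) f_i`. In this labelling the L-space of a
one-vertex graph is spanned by the rows of `(Id | A)`, `A` the intersection matrix. -/
noncomputable def phi' (G : RibbonGraph E) : G.H1 →ₗ[ZMod 2] SymplecticSpace E :=
  ∑ i, (G.capAlpha i).smulRight (SymplecticSpace.e i) +
    ∑ i, (G.capBeta i).smulRight (SymplecticSpace.f i)

/-- The L-space in the labelling `(A | Id)`. -/
noncomputable def lSpace (G : RibbonGraph E) : Submodule (ZMod 2) (SymplecticSpace E) :=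
  LinearMap.range G.phi

/-- The L-space in the labelling `(Id | A)`. -/
noncomputable def lSpace' (G : RibbonGraph E) : Submodule (ZMod 2) (SymplecticSpace E) :=
  LinearMap.range G.phi'

end RibbonGraph

/-! The intersection indices can be read off from local data at the corners. For a cycle `γ` and a
corner `x` of the ribbon `i`, follow `β_i` from the puncture at the end of `x` to the centre of the
ribbon, then `α_i` out to the shore of `x`. Let `w x` be the intersection index of `γ` with this
broken path. The broken path can be pushed, its endpoints staying on the boundary of the surface, to
a path that crosses the sector of the free arc at `x`; hence `w` takes the same value at both ends
of a free arc. On one ribbon each of the four half-paths occurs in two corners, so the four values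
sum to zero. The two corners of a shore share a half of `α_i`, so their values differ by `γ ∩ β_i`;
in the same way the two corners of an end differ by `γ ∩ α_i`.

Conversely, every such colouring comes from a cycle (`IsColouring.exists_cycle`). Thus `lSpace`
consists of the jump vectors of colourings (`mem_lSpace`). Homology has disappeared: only the
involution `arc` matters, and isolated vertices, whose annuli meet no `α` or `β`, contribute
nothing.

Each operation is a `reattach` by a permutation of corners, so it suffices to turn a colouring of
the old graph into one of the new graph and compare jumps. Transposing a ribbon swaps its two jumps,
which gives `M`. For a Vassiliev move, all free arcs keep their colours except the one between the
two neighbouring ends. Each of the two edges then gets the other edge's `endJump` (first move) added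
to its `shoreJump`. In the second move the roles of ends and shores of the fixed edge are
interchanged.

This proves one inclusion. The operations and the linear maps are involutive (a Vassiliev move is
undone by the same kind of move at the opposite corners), so the reverse inclusion is the same
statement for the new graph. The second labelling follows by conjugating with the exchange of `e`
and `f`. -/

namespace RibbonGraph

/-! ### Cycles of the punctured surface and colourings of the corners -/

section Colouring

variable {E : Type*}

/-- Functions on the corners that are constant along the free arcs and have vanishing sum over the
corners of every ribbon. They record the sides of a cycle with respect to the paths `α` and `β`:
cut along these paths, the punctured surface falls into discs, one for every free arc. -/
structure IsColouring (G : RibbonGraph E) (w : Corner E → ZMod 2) : Prop where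
  arc : ∀ x, w (G.arc x) = w x
  ribbon : ∀ e, w (e, false, false) + w (e, false, true) +
    (w (e, true, false) + w (e, true, true)) = 0

/-- The jump of a function on the corners along the shores of the ribbon `i`. -/
def shoreJump (w : Corner E → ZMod 2) (i : E) : ZMod 2 := w (i, false, false) + w (i, true, false)

/-- The jump of a function on the corners across the ends of the ribbon `i`. -/
def endJump (w : Corner E → ZMod 2) (i : E) : ZMod 2 := w (i, false, false) + w (i, false, true)

/-- The vector of the jumps. -/
def jumpVector (w : Corner E → ZMod 2) : SymplecticSpace E := Sum.elim (shoreJump w) (endJump w)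

/-- Exactly four segments end at an outer point: a gluing segment, a shore, a free arc and a radial
segment. Reading coefficients turns the cycle condition into one equation per point. -/
theorem boundary1_outer (G : RibbonGraph E) (c : Chain (Cell1 G)) (x : Corner E) :
    G.boundary1 c (.outer x) = c (.glue x.1 x.2.1) + c (.shore x.1 x.2.2) +
      c (.arc ⟨s(x, G.arc x), x, rfl⟩) + c (.radial x) := by
  classical
  have key : Finsupp.lapply (.outer x) ∘ₗ G.boundary1 =
      (Finsupp.lapply (.glue x.1 x.2.1) + Finsupp.lapply (.shore x.1 x.2.2) +
      Finsupp.lapply (.arc ⟨s(x, G.arc x), x, rfl⟩) + Finsupp.lapply (.radial x) :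
        Chain (Cell1 G) →ₗ[ZMod 2] ZMod 2) := by
    apply Finsupp.lhom_ext'
    intro c
    apply LinearMap.ext_ring
    change G.boundary1 (cell c) (.outer x) = _
    rw [boundary1_cell]
    obtain ⟨k, s, t⟩ := x
    rcases c with ⟨e, s'⟩ | ⟨e, t'⟩ | ⟨p, hp⟩ | y | ⟨e, s'⟩ | ⟨p, hp⟩ | v | v | v
    · by_cases h : e = k <;> cases s <;> cases s' <;> cases t <;>
        simp [bd1, h]
    · by_cases h : e = k <;> cases s <;> cases t' <;> cases t <;>
        simp [bd1, h]
    · obtain ⟨a, rfl⟩ := hp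
      -- Without distinct endpoints the arc would be a loop, with boundary zero modulo 2.
      have hne := G.arc_ne a
      by_cases h1 : a = (k, s, t)
      · subst h1
        simp [bd1, pairSum_mk, hne]
      · by_cases h2 : G.arc a = (k, s, t)
        · have h3 : G.arc (k, s, t) = a := by rw [← h2, G.arc_arc]
          simp [bd1, pairSum_mk, h1, h2, h3, Sym2.eq_swap]
        · have h3 : Cell1.arc (⟨s(a, G.arc a), a, rfl⟩ : G.Arc) ≠
              .arc ⟨s((k, s, t), G.arc (k, s, t)), (k, s, t), rfl⟩ := by
            intro h
            rcases Sym2.eq_iff.mp (congrArg Subtype.val (Cell1.arc.inj h)) with h | h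
            exacts [h1 h.1, h2 h.2]
          simp [bd1, pairSum_mk, h1, h2, h3]
    · simp [bd1, Finsupp.single_apply]
    · simp [bd1]
    · induction p using Sym2.ind with
      | _ a b => simp [bd1, pairSum_mk]
    · simp [bd1]
    · simp [bd1]
    · simp [bd1]
  exact LinearMap.congr_fun key c

theorem boundary1_inner (G : RibbonGraph E) (c : Chain (Cell1 G)) (x : Corner E) :
    G.boundary1 c (.inner x) = c (.innerGlue x.1 x.2.1) +
      c (.innerArc ⟨s(x, G.arc x), x, rfl⟩) + c (.radial x) := by
  classical
  have key : Finsupp.lapply (.inner x) ∘ₗ G.boundary1 =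
      (Finsupp.lapply (.innerGlue x.1 x.2.1) +
      Finsupp.lapply (.innerArc ⟨s(x, G.arc x), x, rfl⟩) + Finsupp.lapply (.radial x) :
        Chain (Cell1 G) →ₗ[ZMod 2] ZMod 2) := by
    apply Finsupp.lhom_ext'
    intro c
    apply LinearMap.ext_ring
    change G.boundary1 (cell c) (.inner x) = _
    rw [boundary1_cell]
    obtain ⟨k, s, t⟩ := x
    rcases c with ⟨e, s'⟩ | ⟨e, t'⟩ | ⟨p, hp⟩ | y | ⟨e, s'⟩ | ⟨p, hp⟩ | v | v | v
    · simp [bd1]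
    · simp [bd1]
    · induction p using Sym2.ind with
      | _ a b => simp [bd1, pairSum_mk]
    · simp [bd1, Finsupp.single_apply]
    · by_cases h : e = k <;> cases s <;> cases s' <;> cases t <;>
        simp [bd1, h]
    · obtain ⟨a, rfl⟩ := hp
      have hne := G.arc_ne a
      by_cases h1 : a = (k, s, t)
      · subst h1
        simp [bd1, pairSum_mk, hne]
      · by_cases h2 : G.arc a = (k, s, t)
        · have h3 : G.arc (k, s, t) = a := by rw [← h2, G.arc_arc]
          simp [bd1, pairSum_mk, h1, h2, h3, Sym2.eq_swap]
        · have h3 : Cell1.innerArc (⟨s(a, G.arc a), a, rfl⟩ : G.Arc) ≠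
              .innerArc ⟨s((k, s, t), G.arc (k, s, t)), (k, s, t), rfl⟩ := by
            intro h
            rcases Sym2.eq_iff.mp (congrArg Subtype.val (Cell1.innerArc.inj h)) with h | h
            exacts [h1 h.1, h2 h.2]
          simp [bd1, pairSum_mk, h1, h2, h3]
    · simp [bd1]
    · simp [bd1]
    · simp [bd1]
  exact LinearMap.congr_fun key c

theorem boundary1_isoOuter (G : RibbonGraph E) (c : Chain (Cell1 G)) (v : Fin G.isolated) :
    G.boundary1 c (.isoOuter v) = c (.isoRadial v) := by
  classical
  have key : Finsupp.lapply (.isoOuter v) ∘ₗ G.boundary1 =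
      (Finsupp.lapply (.isoRadial v) : Chain (Cell1 G) →ₗ[ZMod 2] ZMod 2) := by
    apply Finsupp.lhom_ext'
    intro c
    apply LinearMap.ext_ring
    change G.boundary1 (cell c) (.isoOuter v) = _
    rw [boundary1_cell]
    rcases c with ⟨e, s'⟩ | ⟨e, t'⟩ | ⟨⟨a, b⟩, hp⟩ | y | ⟨e, s'⟩ | ⟨⟨a, b⟩, hp⟩ | v | v | v <;>
      simp [bd1, pairSum, Finsupp.single_apply]
  exact LinearMap.congr_fun key c

theorem boundary1_isoInner (G : RibbonGraph E) (c : Chain (Cell1 G)) (v : Fin G.isolated) :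
    G.boundary1 c (.isoInner v) = c (.isoRadial v) := by
  classical
  have key : Finsupp.lapply (.isoInner v) ∘ₗ G.boundary1 =
      (Finsupp.lapply (.isoRadial v) : Chain (Cell1 G) →ₗ[ZMod 2] ZMod 2) := by
    apply Finsupp.lhom_ext'
    intro c
    apply LinearMap.ext_ring
    change G.boundary1 (cell c) (.isoInner v) = _
    rw [boundary1_cell]
    rcases c with ⟨e, s'⟩ | ⟨e, t'⟩ | ⟨⟨a, b⟩, hp⟩ | y | ⟨e, s'⟩ | ⟨⟨a, b⟩, hp⟩ | v | v | v <;>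
      simp [bd1, pairSum, Finsupp.single_apply]
  exact LinearMap.congr_fun key c

/-- The colouring of the corners defined by a 1-chain. -/
noncomputable def chainColour (G : RibbonGraph E) (c : Chain (Cell1 G)) (x : Corner E) : ZMod 2 :=
  c (.shore x.1 x.2.2) + (c (.glue x.1 x.2.1) + c (.innerGlue x.1 x.2.1))

theorem isColouring_chainColour (G : RibbonGraph E) {c : Chain (Cell1 G)}
    (hc : G.boundary1 c = 0) : G.IsColouring (G.chainColour c) := by
  -- The radial segment at `x` enters the equations of both the outer and the inner point, so it
  -- cancels in their sum. The right-hand side depends only on the free arc, not on which of its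
  -- ends is `x`.
  have key (x : Corner E) : G.chainColour c x =
      c (.arc ⟨s(x, G.arc x), x, rfl⟩) + c (.innerArc ⟨s(x, G.arc x), x, rfl⟩) := by
    have h1 := G.boundary1_outer c x
    have h2 := G.boundary1_inner c x
    rw [hc, Finsupp.zero_apply] at h1 h2
    unfold chainColour
    grind
  constructor
  · intro x
    have h : s(G.arc x, G.arc (G.arc x)) = s(x, G.arc x) := by rw [G.arc_arc, Sym2.eq_swap]
    rw [key, key]
    simp only [h]
  · intro e
    simp only [chainColour]
    grind

/-- The term of the common shore cancels, and what remains are the two halves of `β_i`. For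
`endJump` below, the terms of the common end cancel and the two halves of `α_i` remain. -/
theorem shoreJump_chainColour (G : RibbonGraph E) (c : Chain (Cell1 G)) (i : E) :
    shoreJump (G.chainColour c) i = G.betaChain i c := by
  simp only [shoreJump, chainColour, betaChain, LinearMap.add_apply, Finsupp.lapply_apply]
  grind

theorem endJump_chainColour (G : RibbonGraph E) (c : Chain (Cell1 G)) (i : E) :
    endJump (G.chainColour c) i = G.alphaChain i c := by
  simp only [endJump, chainColour, alphaChain, LinearMap.add_apply, Finsupp.lapply_apply]
  grind

instance (G : RibbonGraph E) [Finite E] : Finite G.Arc := by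
  unfold Arc
  infer_instance

instance (G : RibbonGraph E) [Finite E] : Finite (Cell1 G) := by
  let F : (E × Bool) ⊕ (E × Bool) ⊕ G.Arc ⊕ Corner E ⊕ (E × Bool) ⊕ G.Arc ⊕ Fin G.isolated ⊕
      Fin G.isolated ⊕ Fin G.isolated → Cell1 G :=
    Sum.elim (fun p => .glue p.1 p.2) <| Sum.elim (fun p => .shore p.1 p.2) <| Sum.elim .arc <|
    Sum.elim .radial <| Sum.elim (fun p => .innerGlue p.1 p.2) <| Sum.elim .innerArc <|
    Sum.elim .isoOuter <| Sum.elim .isoInner .isoRadial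
  refine Finite.of_surjective F ?_
  rintro (⟨e, s⟩ | ⟨e, t⟩ | a | y | ⟨e, s⟩ | a | v | v | v)
  · exact ⟨.inl (e, s), rfl⟩
  · exact ⟨.inr (.inl (e, t)), rfl⟩
  · exact ⟨.inr (.inr (.inl a)), rfl⟩
  · exact ⟨.inr (.inr (.inr (.inl y))), rfl⟩
  · exact ⟨.inr (.inr (.inr (.inr (.inl (e, s))))), rfl⟩
  · exact ⟨.inr (.inr (.inr (.inr (.inr (.inl a))))), rfl⟩
  · exact ⟨.inr (.inr (.inr (.inr (.inr (.inr (.inl v)))))), rfl⟩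
  · exact ⟨.inr (.inr (.inr (.inr (.inr (.inr (.inr (.inl v))))))), rfl⟩
  · exact ⟨.inr (.inr (.inr (.inr (.inr (.inr (.inr (.inr v))))))), rfl⟩

theorem IsColouring.exists_cycle [Finite E] {G : RibbonGraph E} {w : Corner E → ZMod 2}
    (hw : G.IsColouring w) : ∃ c, G.boundary1 c = 0 ∧ G.chainColour c = w := by
  -- The cycle is sought on gluing segments, shores and free arcs only. Its values are forced by
  -- `chainColour`, normalised to be zero on the gluing segment of the end `false`.
  let c : Chain (Cell1 G) := Finsupp.equivFunOnFinite.symm fun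
    | .glue e s => w (e, s, false) + w (e, false, false)
    | .shore e t => w (e, false, t)
    | .arc a => w (Quot.out a.1).1
    | _ => 0
  have hcolour : G.chainColour c = w := by
    ext ⟨e, s, t⟩
    have h := hw.ribbon e
    simp only [chainColour, c, Finsupp.coe_equivFunOnFinite_symm]
    -- The ribbon relation is what gives the fourth corner `(true, true)`; the other three hold by
    -- the choice of `c`.
    cases s <;> cases t <;> grind
  have harc (x : Corner E) : c (.arc ⟨s(x, G.arc x), x, rfl⟩) = w x := by
    -- `Quot.out` may select either end of the free arc; `w` agrees on both.
    have h : s((Quot.out s(x, G.arc x)).1, (Quot.out s(x, G.arc x)).2) = s(x, G.arc x) :=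
      Quot.out_eq s(x, G.arc x)
    change w (Quot.out s(x, G.arc x)).1 = w x
    rcases Sym2.eq_iff.mp h with h | h
    · rw [h.1]
    · rw [h.1, hw.arc]
  refine ⟨c, ?_, hcolour⟩
  ext (x | x | v | v)
  · rw [boundary1_outer, harc]
    have h : c (.shore x.1 x.2.2) + (c (.glue x.1 x.2.1) + 0) = w x := congrFun hcolour x
    have h0 : c (.radial x) = 0 := rfl
    rw [Finsupp.zero_apply]
    grind
  · rw [boundary1_inner]
    change (0 : ZMod 2) + 0 + 0 = 0
    simp
  · rw [boundary1_isoOuter]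
    rfl
  · rw [boundary1_isoInner]
    rfl

end Colouring

/-! ### The L-space as the space of jump vectors -/

section LSpace

variable {E : Type*} [Fintype E] [DecidableEq E]

theorem phi_mk (G : RibbonGraph E) (c : Chain (Cell1 G))
    (h : (LinearMap.range G.boundary2).mkQ c ∈ G.H1) :
    G.phi ⟨(LinearMap.range G.boundary2).mkQ c, h⟩ = jumpVector (G.chainColour c) := by
  ext (k | k)
  · rw [jumpVector, Sum.elim_inl, shoreJump_chainColour]
    simp [phi, SymplecticSpace.e, SymplecticSpace.f, Pi.single_apply, Finset.sum_apply]
    rfl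
  · rw [jumpVector, Sum.elim_inr, endJump_chainColour]
    simp [phi, SymplecticSpace.e, SymplecticSpace.f, Pi.single_apply, Finset.sum_apply]
    rfl

theorem mem_lSpace (G : RibbonGraph E) (v : SymplecticSpace E) :
    v ∈ G.lSpace ↔ ∃ w, G.IsColouring w ∧ jumpVector w = v := by
  constructor
  · rintro ⟨⟨_, c, hc, rfl⟩, rfl⟩
    exact ⟨G.chainColour c, G.isColouring_chainColour hc, (G.phi_mk c _).symm⟩
  · rintro ⟨w, hw, rfl⟩
    obtain ⟨c, hc, rfl⟩ := hw.exists_cycle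
    exact ⟨⟨_, c, hc, rfl⟩, G.phi_mk c _⟩

end LSpace

end RibbonGraph
-- Linear algebra: exchange of letters, coordinate formulas, involutivity
namespace SymplecticSpace

/-- The exchange of the letters `e` and `f`. -/
def exchange (E : Type*) : SymplecticSpace E →ₗ[ZMod 2] SymplecticSpace E :=
  LinearMap.funLeft (ZMod 2) (ZMod 2) Sum.swap

theorem exchange_exchange {E : Type*} (v : SymplecticSpace E) :
    exchange E (exchange E v) = v := by
  ext (k | k) <;> rfl

theorem exchange_e {E : Type*} [DecidableEq E] (i : E) : exchange E (e i) = f i := by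
  ext (k | k) <;> simp [exchange, LinearMap.funLeft_apply, e, f, Pi.single_apply]

theorem exchange_f {E : Type*} [DecidableEq E] (i : E) : exchange E (f i) = e i := by
  rw [← exchange_e, exchange_exchange]

variable {E : Type*} [Fintype E] [DecidableEq E]

theorem ofBasis_eq {a b : E → SymplecticSpace E}
    {T : SymplecticSpace E →ₗ[ZMod 2] SymplecticSpace E} (ha : ∀ k, T (e k) = a k)
    (hb : ∀ k, T (f k) = b k) : ofBasis a b = T := by
  refine (Pi.basisFun (ZMod 2) (E ⊕ E)).ext ?_
  rintro (k | k)
  · rw [ofBasis, Module.Basis.constr_basis, Sum.elim_inl, ← ha, Pi.basisFun_apply, e]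
  · rw [ofBasis, Module.Basis.constr_basis, Sum.elim_inr, ← hb, Pi.basisFun_apply, f]

/-- In characteristic 2, swapping two coordinates amounts to adding their sum to each of them. -/
theorem M_apply (i : E) (v : SymplecticSpace E) :
    M i v = v + (v (.inl i) • (e i + f i) + v (.inr i) • (e i + f i)) := by
  let T : SymplecticSpace E →ₗ[ZMod 2] SymplecticSpace E :=
    .id + ((LinearMap.proj (Sum.inl i)).smulRight (e i + f i) +
      (LinearMap.proj (Sum.inr i)).smulRight (e i + f i))
  have h : M i = T := by
    apply ofBasis_eq
    all_goals
      intro k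
      by_cases h : k = i
      · subst h
        ext (l | l) <;> simp [T, e, f]
        all_goals grind
      · simp [T, e, f, h]
  rw [h]
  rfl

theorem T1_apply (i j : E) (hij : i ≠ j) (v : SymplecticSpace E) :
    T1 i j v = v + (v (.inr i) • e j + v (.inr j) • e i) := by
  let T : SymplecticSpace E →ₗ[ZMod 2] SymplecticSpace E :=
    .id + ((LinearMap.proj (Sum.inr i)).smulRight (e j) + (LinearMap.proj (Sum.inr j)).smulRight (e i))
  have h : T1 i j = T := by
    apply ofBasis_eq
    · intro k
      simp [T, e]
    · intro k
      by_cases h : k = i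
      · subst h
        simp [T, f, hij.symm]
      · by_cases h' : k = j
        · subst h'
          simp [T, f, hij, hij.symm]
        · simp [T, f, h, h', Ne.symm h, Ne.symm h']
  rw [h]
  rfl

theorem T2_apply (i j : E) (v : SymplecticSpace E) :
    T2 i j v = v + (v (.inl i) • e j + v (.inr j) • f i) := by
  let T : SymplecticSpace E →ₗ[ZMod 2] SymplecticSpace E :=
    .id + ((LinearMap.proj (Sum.inl i)).smulRight (e j) + (LinearMap.proj (Sum.inr j)).smulRight (f i))
  have h : T2 i j = T := by
    apply ofBasis_eq
    · intro k
      by_cases h : k = i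
      · subst h
        simp [T, e]
      · simp [T, e, h, Ne.symm h]
    · intro k
      by_cases h : k = j
      · subst h
        simp [T, f]
      · simp [T, f, h, Ne.symm h]
  rw [h]
  rfl

/-- Conjugation by `exchange` swaps the two lists of images and exchanges the letters inside them;
it produces the primed maps from the unprimed ones. -/
theorem ofBasis_exchange (a b : E → SymplecticSpace E) :
    ofBasis (fun k => exchange E (b k)) (fun k => exchange E (a k)) =
      exchange E ∘ₗ ofBasis a b ∘ₗ exchange E := by
  have ha (k : E) : ofBasis a b (e k) = a k :=
    (Pi.basisFun_apply (ZMod 2) (E ⊕ E) (.inl k) ▸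
      (Pi.basisFun (ZMod 2) (E ⊕ E)).constr_basis (ZMod 2) (Sum.elim a b) (.inl k) :)
  have hb (k : E) : ofBasis a b (f k) = b k :=
    (Pi.basisFun_apply (ZMod 2) (E ⊕ E) (.inr k) ▸
      (Pi.basisFun (ZMod 2) (E ⊕ E)).constr_basis (ZMod 2) (Sum.elim a b) (.inr k) :)
  apply ofBasis_eq
  · intro k
    simp only [LinearMap.comp_apply, exchange_e, hb]
  · intro k
    simp only [LinearMap.comp_apply, exchange_f, ha]

theorem M_exchange (i : E) : M i = exchange E ∘ₗ M i ∘ₗ exchange E := by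
  rw [M, ← ofBasis_exchange]
  simp only [apply_ite (exchange E), exchange_e, exchange_f]

theorem T1'_eq (i j : E) : T1' i j = exchange E ∘ₗ T1 i j ∘ₗ exchange E := by
  rw [T1, ← ofBasis_exchange]
  simp only [apply_ite (exchange E), map_add, exchange_e, exchange_f]
  rfl

theorem T2'_eq (i j : E) : T2' i j = exchange E ∘ₗ T2 i j ∘ₗ exchange E := by
  rw [T2, ← ofBasis_exchange]
  simp only [apply_ite (exchange E), map_add, exchange_e, exchange_f]
  rfl

theorem M_M (i : E) (v : SymplecticSpace E) : M i (M i v) = v := by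
  simp only [M_apply]
  ext (k | k) <;> by_cases h : k = i <;> simp [e, f, h]
  all_goals grind

theorem T1_T1 (i j : E) (hij : i ≠ j) (v : SymplecticSpace E) : T1 i j (T1 i j v) = v := by
  simp only [T1_apply i j hij]
  ext (k | k) <;> simp [e]
  grind

theorem T2_T2 (i j : E) (hij : i ≠ j) (v : SymplecticSpace E) : T2 i j (T2 i j v) = v := by
  simp only [T2_apply i j]
  ext (k | k) <;> simp [e, f, hij, hij.symm] <;> grind

end SymplecticSpace

namespace RibbonGraph

/-! ### Jumps at arbitrary corners, and colourings after reattaching -/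

section Jumps

variable {E : Type*} {G : RibbonGraph E} {w : Corner E → ZMod 2}

/-- The ribbon relation makes the jumps along the two shores equal, so the choice of shore in
`shoreJump` is immaterial. The next lemma does the same for the ends. -/
theorem IsColouring.add_alongShore (hw : G.IsColouring w) (x : Corner E) :
    w x + w x.alongShore = shoreJump w x.1 := by
  obtain ⟨i, s, t⟩ := x
  have h := hw.ribbon i
  cases s <;> cases t <;> simp only [Corner.alongShore, shoreJump, Bool.not_true, Bool.not_false] <;>
    grind

theorem IsColouring.add_acrossEnd (hw : G.IsColouring w) (x : Corner E) :
    w x + w x.acrossEnd = endJump w x.1 := by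
  obtain ⟨i, s, t⟩ := x
  have h := hw.ribbon i
  cases s <;> cases t <;> simp only [Corner.acrossEnd, endJump, Bool.not_true, Bool.not_false] <;>
    grind

theorem reattach_reattach (G : RibbonGraph E) (σ : Equiv.Perm (Corner E)) (h : σ * σ = 1) :
    (G.reattach σ).reattach σ = G := by
  have h1 (x : Corner E) : σ (σ x) = x := by
    rw [← Equiv.Perm.mul_apply, h, Equiv.Perm.one_apply]
  have h2 (x : Corner E) : σ.symm (σ.symm x) = x := by
    rw [Equiv.symm_apply_eq, Equiv.symm_apply_eq, h1]
  have h3 : ((G.reattach σ).reattach σ).arc = G.arc := by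
    funext x
    simp only [reattach, h1, h2]
  obtain ⟨a, _, _, n⟩ := G
  simp only [reattach] at h3 ⊢
  congr

/-- It suffices to check the invariance under the arcs before the operation. -/
theorem isColouring_reattach (σ : Equiv.Perm (Corner E)) (harc : ∀ x, w (σ (G.arc x)) = w (σ x))
    (hribbon : ∀ e, w (e, false, false) + w (e, false, true) +
      (w (e, true, false) + w (e, true, true)) = 0) : (G.reattach σ).IsColouring w where
  arc x := by
    change w (σ (G.arc (σ.symm x))) = w x
    rw [harc, Equiv.apply_symm_apply]
  ribbon := hribbon

theorem transposeEdge_apply [DecidableEq E] (i : E) (x : Corner E) :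
    transposeEdge i x = if x.1 = i then (x.1, x.2.2, x.2.1) else x := rfl

theorem swap_mul_swap_sq {α : Type*} [DecidableEq α] {a b c d : α} (hac : a ≠ c) (had : a ≠ d)
    (hbc : b ≠ c) (hbd : b ≠ d) :
    (Equiv.swap a b * Equiv.swap c d) * (Equiv.swap a b * Equiv.swap c d) = 1 := by
  ext z
  simp only [Equiv.Perm.mul_apply, Equiv.swap_apply_def, Equiv.Perm.one_apply]
  grind

end Jumps

/-! ### Transfer to the second labelling, and the partial dual -/

section Moves

variable {E : Type*} [Fintype E] [DecidableEq E]

open SymplecticSpace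

theorem lSpace'_eq (G : RibbonGraph E) : G.lSpace' = G.lSpace.map (exchange E) := by
  have h : G.phi' = exchange E ∘ₗ G.phi := by
    ext1 γ
    simp only [phi', phi, LinearMap.comp_apply, LinearMap.add_apply, LinearMap.sum_apply,
      LinearMap.smulRight_apply, map_add, map_sum, map_smul, exchange_e, exchange_f]
    exact add_comm _ _
  rw [lSpace', lSpace, h, LinearMap.range_comp]

theorem lSpace'_eq_map {G H : RibbonGraph E}
    {T : SymplecticSpace E →ₗ[ZMod 2] SymplecticSpace E} (h : H.lSpace = G.lSpace.map T) :
    H.lSpace' = G.lSpace'.map (exchange E ∘ₗ T ∘ₗ exchange E) := by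
  have hx : (exchange E ∘ₗ T ∘ₗ exchange E) ∘ₗ exchange E = exchange E ∘ₗ T := by
    refine LinearMap.ext fun v => ?_
    simp only [LinearMap.comp_apply, exchange_exchange]
  rw [lSpace'_eq, lSpace'_eq, h, ← Submodule.map_comp, ← Submodule.map_comp, hx]

/-- With `T` an involution, the second inclusion is the first one for the inverse operation, so
equality costs only one direction for each operation. -/
theorem lSpace_eq_map {G H : RibbonGraph E}
    {T : SymplecticSpace E →ₗ[ZMod 2] SymplecticSpace E} (hT : ∀ v, T (T v) = v)
    (h : G.lSpace.map T ≤ H.lSpace) (h' : H.lSpace.map T ≤ G.lSpace) :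
    H.lSpace = G.lSpace.map T := by
  refine le_antisymm (fun v hv => ⟨T v, h' ⟨v, hv, rfl⟩, hT v⟩) h

/-- Transposing the rectangle `i` fixes its corners `(false, false)` and `(true, true)` and swaps
the other two, so it exchanges `shoreJump` and `endJump` at `i`. -/
theorem map_lSpace_partialDual_le (G : RibbonGraph E) (i : E) :
    G.lSpace.map (M i) ≤ (G.partialDual i).lSpace := by
  rintro _ ⟨v, hv, rfl⟩
  obtain ⟨w, hw, rfl⟩ := (G.mem_lSpace v).mp hv
  refine (mem_lSpace _ _).mpr ⟨w ∘ transposeEdge i, isColouring_reattach _ ?_ ?_, ?_⟩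
  · intro x
    have h (z : Corner E) : transposeEdge i (transposeEdge i z) = z :=
      (transposeEdge i).symm_apply_apply z
    simp only [Function.comp_apply, h, hw.arc]
  · intro e
    have h := hw.ribbon e
    by_cases he : e = i <;> simp only [Function.comp_apply, transposeEdge_apply, he, if_true, if_false] <;> grind
  · rw [M_apply]
    ext (k | k) <;> by_cases h : k = i <;>
      simp [jumpVector, shoreJump, endJump, transposeEdge_apply, e, f, h] <;> grind

theorem lSpace_partialDual (G : RibbonGraph E) (i : E) :
    (G.partialDual i).lSpace = G.lSpace.map (M i) := by
  refine lSpace_eq_map (M_M i) (G.map_lSpace_partialDual_le i) ?_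
  have h : (G.partialDual i).partialDual i = G := by
    refine G.reattach_reattach (transposeEdge i) (Equiv.ext fun z => ?_)
    exact (transposeEdge i).symm_apply_apply z
  simpa only [h] using (G.partialDual i).map_lSpace_partialDual_le i

end Moves
end RibbonGraph
namespace RibbonGraph

/-! ### The two Vassiliev moves -/

section Vassiliev

variable {E : Type*} [Fintype E] [DecidableEq E]

open SymplecticSpace

theorem map_lSpace_vassiliev1_le (G : RibbonGraph E) {i j : E} {s t s' t' : Bool} (hij : i ≠ j)
    (h : G.arc (i, s, t) = (j, s', t')) :
    G.lSpace.map (T1 i j) ≤ (G.vassiliev1 (i, s, t) (j, s', t')).lSpace := by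
  rintro _ ⟨v, hv, rfl⟩
  obtain ⟨w, hw, rfl⟩ := (G.mem_lSpace v).mp hv
  have hx : w (i, s, t) + w (i, s, !t) = endJump w i := hw.add_acrossEnd (i, s, t)
  have hy : w (j, s', t') + w (j, s', !t') = endJump w j := hw.add_acrossEnd (j, s', t')
  have hxy : w (j, s', t') = w (i, s, t) := h ▸ hw.arc (i, s, t)
  -- Each moved end passes over the other one, so the colours at its corners shift by the jump
  -- across that other end. The shift is constant on an end: it preserves the ribbon relation and
  -- `endJump`, and changes `shoreJump`.
  let w' : Corner E → ZMod 2 := fun z => w z + if z.1 = i ∧ z.2.1 = s then endJump w j else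
    if z.1 = j ∧ z.2.1 = s' then endJump w i else 0
  refine (mem_lSpace _ _).mpr ⟨w', isColouring_reattach _ ?_ ?_, ?_⟩
  -- Seen from the old places on the boundary, only the free arc between the two ends is recoloured;
  -- the outer neighbouring arcs keep their colours.
  · have key (z : Corner E) : w' ((Equiv.swap (Corner.acrossEnd (i, s, t)) (j, s', t') *
        Equiv.swap (i, s, t) (Corner.acrossEnd (j, s', t'))) z) =
        if z = (i, s, t) ∨ z = (j, s', t') then w (i, s, t) + endJump w i + endJump w j
        else w z := by
      simp only [Equiv.Perm.mul_apply, Equiv.swap_apply_def, Corner.acrossEnd, w']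
      obtain ⟨k, a, b⟩ := z
      by_cases h1 : k = i
      · subst h1
        cases s <;> cases a <;> cases t <;> cases b <;> simp_all <;> grind
      · by_cases h2 : k = j
        · subst h2
          cases s' <;> cases a <;> cases t' <;> cases b <;> simp_all <;> grind
        · simp [h1, h2]
    intro z
    rw [key, key, hw.arc]
    have h1 : G.arc (j, s', t') = (i, s, t) := by rw [← h, G.arc_arc]
    -- The two recoloured places are the ends of one free arc, so constancy along arcs survives.
    have h2 : (G.arc z = (i, s, t) ∨ G.arc z = (j, s', t')) ↔
        (z = (i, s, t) ∨ z = (j, s', t')) := by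
      have := G.arc_arc z
      grind
    simp only [h2]
  · intro e
    have := hw.ribbon e
    simp only [w']
    cases s <;> cases s' <;> grind
  · rw [T1_apply i j hij]
    ext (k | k)
    · simp only [jumpVector, shoreJump, w', SymplecticSpace.e, Sum.elim_inl, Sum.elim_inr,
        Pi.add_apply, Pi.smul_apply, Pi.single_apply, Sum.inl.injEq, smul_eq_mul]
      cases s <;> cases s' <;> grind
    · simp only [jumpVector, endJump, w', SymplecticSpace.e, Sum.elim_inr, Pi.add_apply,
        Pi.smul_apply, Pi.single_apply, reduceCtorEq, smul_eq_mul]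
      cases s <;> cases s' <;> grind

/-- This is the first move with ends and shores of the fixed edge `i` interchanged, that is, the
first move conjugated by the partial dual at `i`. -/
theorem map_lSpace_vassiliev2_le (G : RibbonGraph E) {i j : E} {s t s' t' : Bool} (hij : i ≠ j)
    (h : G.arc (i, s, t) = (j, s', t')) :
    G.lSpace.map (T2 i j) ≤ (G.vassiliev2 (i, s, t) (j, s', t')).lSpace := by
  rintro _ ⟨v, hv, rfl⟩
  obtain ⟨w, hw, rfl⟩ := (G.mem_lSpace v).mp hv
  have hx : w (i, s, t) + w (i, !s, t) = shoreJump w i := hw.add_alongShore (i, s, t)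
  have hy : w (j, s', t') + w (j, s', !t') = endJump w j := hw.add_acrossEnd (j, s', t')
  have hxy : w (j, s', t') = w (i, s, t) := h ▸ hw.arc (i, s, t)
  -- The shift on `i` is constant on the shore `t`, along which `j` slides: it changes `endJump w i`
  -- and keeps `shoreJump w i`. The end of `j` passes from one end of this shore to the other and
  -- shifts by the jump along it.
  let w' : Corner E → ZMod 2 := fun z => w z + if z.1 = i ∧ z.2.2 = t then endJump w j else
    if z.1 = j ∧ z.2.1 = s' then shoreJump w i else 0
  refine (mem_lSpace _ _).mpr ⟨w', isColouring_reattach _ ?_ ?_, ?_⟩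
  · have key (z : Corner E) : w' ((Equiv.swap (Corner.alongShore (i, s, t)) (j, s', t') *
        Equiv.swap (i, s, t) (Corner.acrossEnd (j, s', t'))) z) =
        if z = (i, s, t) ∨ z = (j, s', t') then w (i, s, t) + shoreJump w i + endJump w j
        else w z := by
      simp only [Equiv.Perm.mul_apply, Equiv.swap_apply_def, Corner.acrossEnd, Corner.alongShore,
        w']
      obtain ⟨k, a, b⟩ := z
      by_cases h1 : k = i
      · subst h1
        cases s <;> cases a <;> cases t <;> cases b <;> simp_all <;> grind
      · by_cases h2 : k = j
        · subst h2
          cases s' <;> cases a <;> cases t' <;> cases b <;> simp_all <;> grind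
        · simp [h1, h2]
    intro z
    rw [key, key, hw.arc]
    have h1 : G.arc (j, s', t') = (i, s, t) := by rw [← h, G.arc_arc]
    have h2 : (G.arc z = (i, s, t) ∨ G.arc z = (j, s', t')) ↔
        (z = (i, s, t) ∨ z = (j, s', t')) := by
      have := G.arc_arc z
      grind
    simp only [h2]
  · intro e
    have := hw.ribbon e
    simp only [w']
    cases t <;> cases s' <;> grind
  · rw [T2_apply i j]
    ext (k | k)
    · simp only [jumpVector, shoreJump, w', SymplecticSpace.e, SymplecticSpace.f, Sum.elim_inl,
        Sum.elim_inr, Pi.add_apply, Pi.smul_apply, Pi.single_apply, Sum.inl.injEq, reduceCtorEq,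
        smul_eq_mul]
      cases t <;> cases s' <;> grind
    · simp only [jumpVector, endJump, w', SymplecticSpace.e, SymplecticSpace.f, Sum.elim_inl,
        Sum.elim_inr, Pi.add_apply, Pi.smul_apply, Pi.single_apply, Sum.inr.injEq, reduceCtorEq,
        smul_eq_mul]
      cases t <;> cases s' <;> grind

theorem lSpace_vassiliev1 (G : RibbonGraph E) {i j : E} {s t s' t' : Bool} (hij : i ≠ j)
    (h : G.arc (i, s, t) = (j, s', t')) :
    (G.vassiliev1 (i, s, t) (j, s', t')).lSpace = G.lSpace.map (T1 i j) := by
  -- After the move the formerly outer corners of the two ends are neighbours, and the move at them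
  -- restores the old order. It uses the same two disjoint transpositions in the opposite order,
  -- hence `hcomm`.
  have hback : (G.vassiliev1 (i, s, t) (j, s', t')).vassiliev1 (i, s, !t) (j, s', !t') = G := by
    have hcomm : Equiv.swap (i, s, t) (j, s', !t') * Equiv.swap (i, s, !t) (j, s', t') =
        Equiv.swap (i, s, !t) (j, s', t') * Equiv.swap (i, s, t) (j, s', !t') := by
      ext1 z
      simp only [Equiv.Perm.mul_apply, Equiv.swap_apply_def]
      grind
    simp only [vassiliev1, Corner.acrossEnd, Bool.not_not]
    rw [hcomm]
    apply reattach_reattach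
    apply swap_mul_swap_sq <;> simp [hij, hij.symm]
  have harc : (G.vassiliev1 (i, s, t) (j, s', t')).arc (i, s, !t) = (j, s', !t') := by
    have h1 : G.arc (j, s', t') = (i, s, t) := by rw [← h, G.arc_arc]
    simp [vassiliev1, reattach, Corner.acrossEnd, Equiv.swap_apply_def,
      Equiv.Perm.mul_def, h1, hij.symm]
  refine lSpace_eq_map (T1_T1 i j hij) (G.map_lSpace_vassiliev1_le hij h) ?_
  simpa only [hback] using map_lSpace_vassiliev1_le _ hij harc

theorem lSpace_vassiliev2 (G : RibbonGraph E) {i j : E} {s t s' t' : Bool} (hij : i ≠ j)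
    (h : G.arc (i, s, t) = (j, s', t')) :
    (G.vassiliev2 (i, s, t) (j, s', t')).lSpace = G.lSpace.map (T2 i j) := by
  -- The end of `j` slides back along the same shore, starting from its far corner and leading with
  -- the other corner of the end.
  have hback : (G.vassiliev2 (i, s, t) (j, s', t')).vassiliev2 (i, !s, t) (j, s', !t') = G := by
    have hcomm : Equiv.swap (i, s, t) (j, s', !t') * Equiv.swap (i, !s, t) (j, s', t') =
        Equiv.swap (i, !s, t) (j, s', t') * Equiv.swap (i, s, t) (j, s', !t') := by
      ext1 z
      simp only [Equiv.Perm.mul_apply, Equiv.swap_apply_def]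
      grind
    simp only [vassiliev2, Corner.acrossEnd, Corner.alongShore, Bool.not_not]
    rw [hcomm]
    apply reattach_reattach
    apply swap_mul_swap_sq <;> simp [hij, hij.symm]
  have harc : (G.vassiliev2 (i, s, t) (j, s', t')).arc (i, !s, t) = (j, s', !t') := by
    have h1 : G.arc (j, s', t') = (i, s, t) := by rw [← h, G.arc_arc]
    simp [vassiliev2, reattach, Corner.acrossEnd, Corner.alongShore, Equiv.swap_apply_def,
      Equiv.Perm.mul_def, h1, hij.symm]
  refine lSpace_eq_map (T2_T2 i j hij) (G.map_lSpace_vassiliev2_le hij h) ?_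
  simpa only [hback] using map_lSpace_vassiliev2_le _ hij harc

end Vassiliev

end RibbonGraph

theorem mainTheorem2 {E : Type*} [Fintype E] [DecidableEq E] (G : RibbonGraph E) :
    -- the partial dual, in both labellings
    (∀ i : E,
      (G.partialDual i).lSpace = G.lSpace.map (SymplecticSpace.M i) ∧
      (G.partialDual i).lSpace' = G.lSpace'.map (SymplecticSpace.M i)) ∧
    -- the first Vassiliev move, for neighbouring ends of two distinct edges `i`, `j`
    (∀ (i j : E) (s t s' t' : Bool), i ≠ j → G.arc (i, s, t) = (j, s', t') →
      (G.vassiliev1 (i, s, t) (j, s', t')).lSpace = G.lSpace.map (SymplecticSpace.T1 i j) ∧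
      (G.vassiliev1 (i, s, t) (j, s', t')).lSpace' = G.lSpace'.map (SymplecticSpace.T1' i j)) ∧
    -- the second Vassiliev move, with fixed edge `i` and moving edge `j`
    (∀ (i j : E) (s t s' t' : Bool), i ≠ j → G.arc (i, s, t) = (j, s', t') →
      (G.vassiliev2 (i, s, t) (j, s', t')).lSpace = G.lSpace.map (SymplecticSpace.T2 i j) ∧
      (G.vassiliev2 (i, s, t) (j, s', t')).lSpace' = G.lSpace'.map (SymplecticSpace.T2' i j)) := by
  refine ⟨fun i => ⟨G.lSpace_partialDual i, ?_⟩, fun i j s t s' t' hij h =>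
    ⟨G.lSpace_vassiliev1 hij h, ?_⟩, fun i j s t s' t' hij h => ⟨G.lSpace_vassiliev2 hij h, ?_⟩⟩
  · rw [SymplecticSpace.M_exchange]
    exact RibbonGraph.lSpace'_eq_map (G.lSpace_partialDual i)
  · rw [SymplecticSpace.T1'_eq]
    exact RibbonGraph.lSpace'_eq_map (G.lSpace_vassiliev1 hij h)
  · rw [SymplecticSpace.T2'_eq]
    exact RibbonGraph.lSpace'_eq_map (G.lSpace_vassiliev2 hij h)
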